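/- Let $k$ be a field. For finite groups $G,H$ let $B(G,H)$ be the Burnside group of finite $(G,H)$-bisets, i.e. the Grothendieck group of the category of finite $(G,H)$-bisets with respect to disjoint union, and let $kB(G,H)=k\otimes_{\mathbb Z}B(G,H)$. The biset category $k\mathcal C$ has the finite groups as objects and $\mathrm{Hom}_{k\mathcal C}(H,G)=kB(G,H)$, with composition the $k$-bilinear extension of the product $(U,W)\mapsto U\times_H W$ of bisets. A biset functor is a $k$-linear functor from $k\mathcal C$ to $k$-vector spaces; it is simple if it is non-zero and has no proper non-zero subfunctor. Let $H$ be a finite group and let $V$ be a simple $k\mathrm{Out}(H)$-module. Let $S_{H,V}$ denote the (unique up to isomorphism) simple biset functor $S$ such that $H$ is a group of minimal order with $S(H)\neq 0$ and such that $S(H)\cong V$ as $k\mathrm{Out}(H)$-modules, where the class of an automorphism $\sigma$ of $H$ acts on $S(H)$ by $S(\mathrm{Iso}_\sigma)$, with $\mathrm{Iso}_\sigma$ the set $H$ viewed as an $(H,H)$-biset via $h\cdot x\cdot h'=hx\sigma(h')$. Write $H\sqsubseteq G$ if $H$ is isomorphic to a subquotient $T/N$ of $G$ (where $T\leq G$ and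 $N$ is a normal subgroup of $T$). **Proposition 3.2.** Let $G$ be a finite group. If $H\sqsubseteq G/[G,G]$, then $S_{H,V}(G)\neq 0$. In particular, if $G$ is abelian and $H\sqsubseteq G$, then $H$ is abelian too and $S_{H,V}(G)\neq 0$. -/

import Mathlib

open MulOpposite
open scoped TensorProduct

universe u v w x

/-- A finite `(G, H)`-biset: a finite set with a left `G`-action and a right `H`-action
(i.e. an action of the opposite group of `H`) which commute with each other. -/
structure Biset (G H : Type u) [Group G] [Group H] : Type (u + 1) where
  carrier : Type u
  [left : MulAction G carrier]
  [right : MulAction Hᵐᵒᵖ carrier]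
  [comm : SMulCommClass G Hᵐᵒᵖ carrier]
  [finite : Finite carrier]

attribute [instance] Biset.left Biset.right Biset.comm Biset.finite

namespace Biset

section Basic

variable {G H : Type u} [Group G] [Group H]

/-- Two bisets are isomorphic if there is a bijection compatible with both actions. -/
def IsIso (U V : Biset G H) : Prop :=
  ∃ e : U.carrier ≃ V.carrier,
    (∀ (g : G) (a : U.carrier), e (g • a) = g • e a) ∧
    (∀ (h : H) (a : U.carrier), e (op h • a) = op h • e a)

theorem IsIso.refl (U : Biset G H) : U.IsIso U :=
  ⟨Equiv.refl _, fun _ _ => rfl, fun _ _ => rfl⟩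

theorem IsIso.symm {U V : Biset G H} : U.IsIso V → V.IsIso U := by
  rintro ⟨e, h1, h2⟩
  refine ⟨e.symm, fun g a => ?_, fun h a => ?_⟩
  · rw [Equiv.symm_apply_eq, h1, Equiv.apply_symm_apply]
  · rw [Equiv.symm_apply_eq, h2, Equiv.apply_symm_apply]

theorem IsIso.trans {U V W : Biset G H} : U.IsIso V → V.IsIso W → U.IsIso W := by
  rintro ⟨e, h1, h2⟩ ⟨f, h3, h4⟩
  exact ⟨e.trans f, fun g a => by simp [h1, h3], fun h a => by simp [h2, h4]⟩

instance setoid (G H : Type u) [Group G] [Group H] : Setoid (Biset G H) where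
  r := IsIso
  iseqv := ⟨IsIso.refl, IsIso.symm, IsIso.trans⟩

/-- The disjoint union of two bisets. -/
def sum (U V : Biset G H) : Biset G H where
  carrier := U.carrier ⊕ V.carrier

instance (M : Type u) [Monoid M] : MulAction M PEmpty.{u + 1} where
  smul _ a := a
  one_smul a := a.elim
  mul_smul _ _ a := a.elim

/-- The empty biset. -/
def empty (G H : Type u) [Group G] [Group H] : Biset G H where
  carrier := PEmpty.{u + 1}
  comm := ⟨fun _ _ a => a.elim⟩

theorem IsIso.sum {U U' V V' : Biset G H} : U.IsIso U' → V.IsIso V' →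
    (U.sum V).IsIso (U'.sum V') := by
  rintro ⟨e, h1, h2⟩ ⟨f, h3, h4⟩
  refine ⟨Equiv.sumCongr e f, fun g a => ?_, fun h a => ?_⟩
  · rcases a with a | a
    · exact congrArg Sum.inl (h1 g a)
    · exact congrArg Sum.inr (h3 g a)
  · rcases a with a | a
    · exact congrArg Sum.inl (h2 h a)
    · exact congrArg Sum.inr (h4 h a)

theorem sum_comm_iso (U V : Biset G H) : (U.sum V).IsIso (V.sum U) := by
  refine ⟨Equiv.sumComm _ _, fun g a => ?_, fun h a => ?_⟩ <;> rcases a with a | a <;> rfl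

theorem sum_assoc_iso (U V W : Biset G H) : ((U.sum V).sum W).IsIso (U.sum (V.sum W)) := by
  refine ⟨Equiv.sumAssoc _ _ _, fun g a => ?_, fun h a => ?_⟩ <;>
    rcases a with (a | a) | a <;> rfl

theorem empty_sum_iso (U : Biset G H) : ((empty G H).sum U).IsIso U := by
  refine ⟨Equiv.emptySum PEmpty.{u + 1} U.carrier, fun g a => ?_, fun h a => ?_⟩ <;>
    rcases a with a | a <;> first | exact a.elim | rfl

/-- The right action of `G` on `H` by right multiplication through `σ : G ≃* H`. -/
abbrev isoRight (σ : G ≃* H) : MulAction Gᵐᵒᵖ H where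
  smul g a := a * σ g.unop
  one_smul a := by change a * σ 1 = a; simp
  mul_smul g g' a := by
    change a * σ (g'.unop * g.unop) = a * σ g'.unop * σ g.unop
    simp [mul_assoc]

/-- The `(H, G)`-biset `Iso_σ` attached to a group isomorphism `σ : G ≃* H`: the set `H`, with
`H` acting by left multiplication and `G` by right multiplication through `σ`. -/
def iso [Finite H] (σ : G ≃* H) : Biset H G :=
  letI := isoRight σ
  { carrier := H
    comm := ⟨fun h g a => (mul_assoc h a (σ g.unop)).symm⟩ }

end Basic

section Comp

variable {G H K L : Type u} [Group G] [Group H] [Group K] [Group L]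

/-- The relation `(u h, v) ∼ (u, h v)` on `U × V`; here `(u, v) ∼ (u', v')` means that
`u' = u h` and `v = h v'` for some `h`. -/
def compSetoid (U : Biset G H) (V : Biset H K) : Setoid (U.carrier × V.carrier) where
  r p q := ∃ h : H, q.1 = op h • p.1 ∧ p.2 = h • q.2
  iseqv :=
    { refl := fun p => ⟨1, by simp, by simp⟩
      symm := by
        rintro p q ⟨h, h1, h2⟩
        refine ⟨h⁻¹, ?_, ?_⟩
        · rw [h1, smul_smul, ← op_mul, mul_inv_cancel, op_one, one_smul]
        · rw [h2, smul_smul, inv_mul_cancel, one_smul]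
      trans := by
        rintro p q r ⟨h, h1, h2⟩ ⟨h', h3, h4⟩
        refine ⟨h * h', ?_, ?_⟩
        · rw [h3, h1, smul_smul, ← op_mul]
        · rw [h2, h4, smul_smul] }

/-- The left action of `G` on `U ×_H V`. -/
abbrev compLeft (U : Biset G H) (V : Biset H K) : MulAction G (Quotient (compSetoid U V)) where
  smul g := Quotient.map (fun p => (g • p.1, p.2)) (by
    rintro p q ⟨h, h1, h2⟩
    exact ⟨h, by simp only [h1, smul_comm], h2⟩)
  one_smul := by
    rintro ⟨p⟩
    exact congrArg (Quotient.mk (compSetoid U V)) (Prod.ext (one_smul _ _) rfl)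
  mul_smul := by
    rintro a b ⟨p⟩
    exact congrArg (Quotient.mk (compSetoid U V)) (Prod.ext (mul_smul _ _ _) rfl)

/-- The right action of `K` on `U ×_H V`. -/
abbrev compRight (U : Biset G H) (V : Biset H K) :
    MulAction Kᵐᵒᵖ (Quotient (compSetoid U V)) where
  smul k := Quotient.map (fun p => (p.1, k • p.2)) (by
    rintro p q ⟨h, h1, h2⟩
    exact ⟨h, h1, by simp only [h2, smul_comm]⟩)
  one_smul := by
    rintro ⟨p⟩
    exact congrArg (Quotient.mk (compSetoid U V)) (Prod.ext rfl (one_smul _ _))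
  mul_smul := by
    rintro a b ⟨p⟩
    exact congrArg (Quotient.mk (compSetoid U V)) (Prod.ext rfl (mul_smul _ _ _))

/-- The product `U ×_H V` of a `(G, H)`-biset and an `(H, K)`-biset. -/
def comp (U : Biset G H) (V : Biset H K) : Biset G K :=
  letI := compLeft U V
  letI := compRight U V
  { carrier := Quotient (compSetoid U V)
    comm := ⟨by rintro g k ⟨p⟩; rfl⟩ }

/-- The class of a pair in `U ×_H V`. -/
def comp.mk {U : Biset G H} {V : Biset H K} (a : U.carrier) (b : V.carrier) :
    (U.comp V).carrier :=
  Quotient.mk (compSetoid U V) (a, b)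

theorem comp.mk_smul {U : Biset G H} {V : Biset H K} (h : H) (a : U.carrier) (b : V.carrier) :
    comp.mk (op h • a) b = comp.mk a (h • b) :=
  (Quotient.sound (s := compSetoid U V) ⟨h, rfl, rfl⟩ :
    comp.mk a (h • b) = comp.mk (op h • a) b).symm

theorem IsIso.comp {U U' : Biset G H} {V V' : Biset H K} : U.IsIso U' → V.IsIso V' →
    (U.comp V).IsIso (U'.comp V') := by
  rintro ⟨e, h1, h2⟩ ⟨f, h3, h4⟩
  refine ⟨Quotient.congr (Equiv.prodCongr e f) ?_, ?_, ?_⟩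
  · rintro ⟨a, b⟩ ⟨a', b'⟩
    constructor
    · rintro ⟨h, r1, r2⟩
      exact ⟨h, (congrArg e r1).trans (h2 _ _), (congrArg f r2).trans (h3 _ _)⟩
    · rintro ⟨h, r1, r2⟩
      exact ⟨h, e.injective (r1.trans (h2 _ _).symm), f.injective (r2.trans (h3 _ _).symm)⟩
  · rintro g ⟨a, b⟩
    exact congrArg (Quotient.mk (compSetoid U' V')) (Prod.ext (h1 _ _) rfl)
  · rintro k ⟨a, b⟩
    exact congrArg (Quotient.mk (compSetoid U' V')) (Prod.ext rfl (h4 _ _))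

theorem comp_assoc_iso (U : Biset G H) (V : Biset H K) (W : Biset K L) :
    ((U.comp V).comp W).IsIso (U.comp (V.comp W)) := by
  refine ⟨⟨?_, ?_, ?_, ?_⟩, ?_, ?_⟩
  · refine Quotient.lift (fun p => Quotient.lift
      (fun q : U.carrier × V.carrier => (comp.mk q.1 (comp.mk q.2 p.2) :
        (U.comp (V.comp W)).carrier)) ?_ p.1) ?_
    · rintro ⟨a, b⟩ ⟨a', b'⟩ ⟨h, r1, r2⟩
      dsimp only at r1 r2 ⊢
      subst r1 r2
      exact (comp.mk_smul (V := V.comp W) h a (comp.mk b' p.2)).symm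
    · rintro ⟨⟨a, b⟩, c⟩ ⟨q, c'⟩ ⟨h, r1, r2⟩
      dsimp only at r1 r2 ⊢
      subst r1 r2
      exact congrArg (comp.mk a) (comp.mk_smul h b c').symm
  · refine Quotient.lift (fun p => Quotient.lift
      (fun q : V.carrier × W.carrier => (comp.mk (comp.mk p.1 q.1) q.2 :
        ((U.comp V).comp W).carrier)) ?_ p.2) ?_
    · rintro ⟨a, b⟩ ⟨a', b'⟩ ⟨h, r1, r2⟩
      dsimp only at r1 r2 ⊢
      subst r1 r2
      exact (comp.mk_smul (U := U.comp V) h (comp.mk p.1 a) b').symm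
    · rintro ⟨a, q⟩ ⟨a', ⟨b, c⟩⟩ ⟨h, r1, r2⟩
      dsimp only at r1 r2 ⊢
      subst r1 r2
      exact congrArg (fun t => comp.mk t c) (comp.mk_smul h a b).symm
  · rintro ⟨⟨⟨a, b⟩⟩, c⟩
    rfl
  · rintro ⟨a, ⟨⟨b, c⟩⟩⟩
    rfl
  · rintro g ⟨⟨⟨a, b⟩⟩, c⟩
    rfl
  · rintro g ⟨⟨⟨a, b⟩⟩, c⟩
    rfl

theorem id_comp_iso [Finite G] (U : Biset G H) : ((iso (MulEquiv.refl G)).comp U).IsIso U := by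
  refine ⟨⟨?_, ?_, ?_, ?_⟩, ?_, ?_⟩
  · refine Quotient.lift (fun p : G × U.carrier => p.1 • p.2) ?_
    rintro ⟨a, b⟩ ⟨a', b'⟩ ⟨h, r1, r2⟩
    have r1' : a' = (show G from a) * h := r1
    have r2' : b = h • b' := r2
    change (show G from a) • b = (show G from a') • b'
    rw [r1', r2', smul_smul]
  · exact fun b => comp.mk (U := iso (MulEquiv.refl G)) (1 : G) b
  · rintro ⟨(a : G), b⟩
    refine (comp.mk_smul (U := iso (MulEquiv.refl G)) a (1 : G) b).symm.trans ?_
    exact congrArg (fun t => comp.mk (U := iso (MulEquiv.refl G)) t b) (one_mul a)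
  · intro b
    exact one_smul G b
  · rintro g ⟨(a : G), b⟩
    exact mul_smul g a b
  · rintro h ⟨(a : G), b⟩
    exact smul_comm a (op h) b

theorem comp_id_iso [Finite H] (U : Biset G H) : (U.comp (iso (MulEquiv.refl H))).IsIso U := by
  refine ⟨⟨?_, ?_, ?_, ?_⟩, ?_, ?_⟩
  · refine Quotient.lift (fun p : U.carrier × H => op p.2 • p.1) ?_
    rintro ⟨a, b⟩ ⟨a', b'⟩ ⟨h, r1, r2⟩
    have r1' : a' = op h • a := r1
    have r2' : b = h * (show H from b') := r2
    change op (show H from b) • a = op (show H from b') • a'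
    rw [r1', r2', smul_smul, ← op_mul]
  · exact fun a => comp.mk (V := iso (MulEquiv.refl H)) a (1 : H)
  · rintro ⟨a, (b : H)⟩
    refine (comp.mk_smul (V := iso (MulEquiv.refl H)) b a (1 : H)).trans ?_
    exact congrArg (comp.mk (V := iso (MulEquiv.refl H)) a) (mul_one b)
  · intro a
    exact one_smul Hᵐᵒᵖ a
  · rintro g ⟨a, (b : H)⟩
    exact (smul_comm g (op b) a).symm
  · rintro h ⟨a, (b : H)⟩
    exact mul_smul (op h) (op b) a

theorem sum_comp_iso (U U' : Biset G H) (V : Biset H K) :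
    ((U.sum U').comp V).IsIso ((U.comp V).sum (U'.comp V)) := by
  refine ⟨⟨?_, ?_, ?_, ?_⟩, ?_, ?_⟩
  · refine Quotient.lift (fun p : (U.carrier ⊕ U'.carrier) × V.carrier =>
      (Sum.map (fun a => comp.mk a p.2) (fun a => comp.mk a p.2) p.1 :
        (U.comp V).carrier ⊕ (U'.comp V).carrier)) ?_
    rintro ⟨a | a, b⟩ ⟨a', b'⟩ ⟨h, r1, r2⟩
    · have r1' : a' = Sum.inl (op h • a) := r1
      have r2' : b = h • b' := r2
      subst r1' r2'
      exact congrArg Sum.inl (comp.mk_smul h a b').symm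
    · have r1' : a' = Sum.inr (op h • a) := r1
      have r2' : b = h • b' := r2
      subst r1' r2'
      exact congrArg Sum.inr (comp.mk_smul h a b').symm
  · refine Sum.elim
      (Quotient.map (fun p => ((Sum.inl p.1, p.2) : (U.carrier ⊕ U'.carrier) × V.carrier)) ?_)
      (Quotient.map (fun p => ((Sum.inr p.1, p.2) : (U.carrier ⊕ U'.carrier) × V.carrier)) ?_)
    · rintro p q ⟨h, r1, r2⟩
      exact ⟨h, congrArg Sum.inl r1, r2⟩
    · rintro p q ⟨h, r1, r2⟩
      exact ⟨h, congrArg Sum.inr r1, r2⟩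
  · rintro ⟨a | a, b⟩ <;> rfl
  · rintro (⟨a, b⟩ | ⟨a, b⟩) <;> rfl
  · rintro g ⟨a | a, b⟩ <;> rfl
  · rintro g ⟨a | a, b⟩ <;> rfl

theorem comp_sum_iso (U : Biset G H) (V V' : Biset H K) :
    (U.comp (V.sum V')).IsIso ((U.comp V).sum (U.comp V')) := by
  refine ⟨⟨?_, ?_, ?_, ?_⟩, ?_, ?_⟩
  · refine Quotient.lift (fun p : U.carrier × (V.carrier ⊕ V'.carrier) =>
      (Sum.map (fun b => comp.mk p.1 b) (fun b => comp.mk p.1 b) p.2 :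
        (U.comp V).carrier ⊕ (U.comp V').carrier)) ?_
    rintro ⟨a, b⟩ ⟨a', b' | b'⟩ ⟨h, r1, r2⟩
    · have r1' : a' = op h • a := r1
      have r2' : b = Sum.inl (h • b') := r2
      subst r1' r2'
      exact congrArg Sum.inl (comp.mk_smul h a b').symm
    · have r1' : a' = op h • a := r1
      have r2' : b = Sum.inr (h • b') := r2
      subst r1' r2'
      exact congrArg Sum.inr (comp.mk_smul h a b').symm
  · refine Sum.elim
      (Quotient.map (fun p => ((p.1, Sum.inl p.2) : U.carrier × (V.carrier ⊕ V'.carrier))) ?_)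
      (Quotient.map (fun p => ((p.1, Sum.inr p.2) : U.carrier × (V.carrier ⊕ V'.carrier))) ?_)
    · rintro p q ⟨h, r1, r2⟩
      exact ⟨h, r1, congrArg Sum.inl r2⟩
    · rintro p q ⟨h, r1, r2⟩
      exact ⟨h, r1, congrArg Sum.inr r2⟩
  · rintro ⟨a, b | b⟩ <;> rfl
  · rintro (⟨a, b⟩ | ⟨a, b⟩) <;> rfl
  · rintro g ⟨a, b | b⟩ <;> rfl
  · rintro g ⟨a, b | b⟩ <;> rfl

theorem empty_comp_iso (V : Biset H K) : ((empty G H).comp V).IsIso (empty G K) := by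
  have h1 : IsEmpty ((empty G H).comp V).carrier := ⟨by rintro ⟨a, b⟩; exact a.elim⟩
  have h2 : IsEmpty (empty G K).carrier := ⟨fun a => a.elim⟩
  exact ⟨Equiv.equivOfIsEmpty _ _, fun _ a => isEmptyElim a, fun _ a => isEmptyElim a⟩

theorem comp_empty_iso (U : Biset G H) : (U.comp (empty H K)).IsIso (empty G K) := by
  have h1 : IsEmpty (U.comp (empty H K)).carrier := ⟨by rintro ⟨a, b⟩; exact b.elim⟩
  have h2 : IsEmpty (empty G K).carrier := ⟨fun a => a.elim⟩
  exact ⟨Equiv.equivOfIsEmpty _ _, fun _ a => isEmptyElim a, fun _ a => isEmptyElim a⟩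

end Comp

end Biset

/-- Isomorphism classes of finite `(G, H)`-bisets. -/
def BisetClass (G H : Type u) [Group G] [Group H] : Type (u + 1) :=
  Quotient (Biset.setoid G H)

namespace BisetClass

variable {G H K L : Type u} [Group G] [Group H] [Group K] [Group L]

/-- The isomorphism class of a biset. -/
def mk (U : Biset G H) : BisetClass G H := Quotient.mk _ U

instance : Add (BisetClass G H) where
  add := Quotient.map₂ Biset.sum fun _ _ h _ _ h' => Biset.IsIso.sum h h'

instance : Zero (BisetClass G H) where
  zero := mk (Biset.empty G H)

/-- Isomorphism classes of bisets form a commutative monoid under disjoint union. -/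
instance : AddCommMonoid (BisetClass G H) where
  add_assoc := by
    rintro ⟨U⟩ ⟨V⟩ ⟨W⟩
    exact Quotient.sound (Biset.sum_assoc_iso U V W)
  add_comm := by
    rintro ⟨U⟩ ⟨V⟩
    exact Quotient.sound (Biset.sum_comm_iso U V)
  zero_add := by
    rintro ⟨U⟩
    exact Quotient.sound (Biset.empty_sum_iso U)
  add_zero := by
    rintro ⟨U⟩
    exact Quotient.sound ((Biset.sum_comm_iso U _).trans (Biset.empty_sum_iso U))
  nsmul := nsmulRec

/-- The product `(U, V) ↦ U ×_H V` on isomorphism classes. -/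
def comp : BisetClass G H → BisetClass H K → BisetClass G K :=
  Quotient.map₂ Biset.comp fun _ _ h _ _ h' => Biset.IsIso.comp h h'

/-- The product on isomorphism classes of bisets, as a biadditive map. -/
def compHom : BisetClass G H →+ BisetClass H K →+ BisetClass G K where
  toFun a :=
    { toFun := comp a
      map_zero' := by
        obtain ⟨U⟩ := a
        exact Quotient.sound (Biset.comp_empty_iso U)
      map_add' := by
        obtain ⟨U⟩ := a
        rintro ⟨V⟩ ⟨V'⟩
        exact Quotient.sound (Biset.comp_sum_iso U V V') }
  map_zero' := by
    ext ⟨V⟩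
    exact Quotient.sound (Biset.empty_comp_iso V)
  map_add' := by
    rintro ⟨U⟩ ⟨U'⟩
    ext ⟨V⟩
    exact Quotient.sound (Biset.sum_comp_iso U U' V)

theorem compHom_assoc (a : BisetClass G H) (b : BisetClass H K) (c : BisetClass K L) :
    compHom (compHom a b) c = compHom a (compHom b c) := by
  obtain ⟨U⟩ := a
  obtain ⟨V⟩ := b
  obtain ⟨W⟩ := c
  exact Quotient.sound (Biset.comp_assoc_iso U V W)

theorem id_compHom [Finite G] (a : BisetClass G H) :
    compHom (mk (Biset.iso (MulEquiv.refl G))) a = a := by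
  obtain ⟨U⟩ := a
  exact Quotient.sound (Biset.id_comp_iso U)

theorem compHom_id [Finite H] (a : BisetClass G H) :
    compHom a (mk (Biset.iso (MulEquiv.refl H))) = a := by
  obtain ⟨U⟩ := a
  exact Quotient.sound (Biset.comp_id_iso U)

end BisetClass

noncomputable section

open CategoryTheory

/-- The Burnside group `B(G, H)`: the Grothendieck group of the category of finite
`(G, H)`-bisets with respect to disjoint union. -/
abbrev BurnsideGroup (G H : Type u) [Group G] [Group H] : Type (u + 1) :=
  Algebra.GrothendieckAddGroup (BisetClass G H)

namespace BurnsideGroup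

variable {G H K L : Type u} [Group G] [Group H] [Group K] [Group L]

/-- The class of a biset in the Burnside group. -/
def of (U : Biset G H) : BurnsideGroup G H :=
  Algebra.GrothendieckAddGroup.of (BisetClass.mk U)

theorem induction_on {P : BurnsideGroup G H → Prop} (a : BurnsideGroup G H)
    (of : ∀ U, P (of U)) (sub : ∀ a b, P a → P b → P (a - b)) : P a := by
  induction a using AddLocalization.ind with
  | H y =>
    obtain ⟨⟨U⟩, ⟨V⟩, hV⟩ := y
    have h := sub _ _ (of U) (of V)
    convert h using 1
    simp only [BurnsideGroup.of, Algebra.GrothendieckAddGroup.of]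
    change _ = AddLocalization.addMonoidOf ⊤ _ - AddLocalization.addMonoidOf ⊤ _
    rw [← AddLocalization.mk_zero_eq_addMonoidOf_mk, ← AddLocalization.mk_zero_eq_addMonoidOf_mk,
      Algebra.GrothendieckAddGroup.mk_sub_mk]
    simp
    rfl

theorem lift_of {A : Type*} [AddCommGroup A] (f : BisetClass G H →+ A) (a : BisetClass G H) :
    Algebra.GrothendieckAddGroup.lift f (Algebra.GrothendieckAddGroup.of a) = f a :=
  DFunLike.congr_fun (Algebra.GrothendieckAddGroup.lift.symm_apply_apply f) a

/-- The biadditive composition `B(G, H) × B(H, K) → B(G, K)` induced by `U ×_H V`. -/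
def compHom : BurnsideGroup G H →+ BurnsideGroup H K →+ BurnsideGroup G K :=
  Algebra.GrothendieckAddGroup.lift <| AddMonoidHom.mk'
    (fun a => Algebra.GrothendieckAddGroup.lift
      (Algebra.GrothendieckAddGroup.of.comp (BisetClass.compHom a)))
    (fun a a' => by
      apply Algebra.GrothendieckAddGroup.lift.symm.injective
      ext b
      simp only [Algebra.GrothendieckAddGroup.lift_symm_apply, AddMonoidHom.comp_apply,
        AddMonoidHom.add_apply, lift_of, map_add])

theorem compHom_of (U : Biset G H) (V : Biset H K) :
    compHom (of U) (of V) = of (U.comp V) := by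
  simp only [compHom, of, lift_of, AddMonoidHom.mk'_apply, AddMonoidHom.comp_apply]
  rfl

theorem compHom_assoc (a : BurnsideGroup G H) (b : BurnsideGroup H K) (c : BurnsideGroup K L) :
    compHom (compHom a b) c = compHom a (compHom b c) := by
  induction a using induction_on with
  | sub a a' h h' => simp only [map_sub, AddMonoidHom.sub_apply, h, h']
  | of U =>
    induction b using induction_on with
    | sub b b' h h' => simp only [map_sub, AddMonoidHom.sub_apply, h, h']
    | of V =>
      induction c using induction_on with
      | sub c c' h h' => simp only [map_sub, h, h']
      | of W =>
        simp only [compHom_of]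
        exact congrArg Algebra.GrothendieckAddGroup.of
          (Quotient.sound (Biset.comp_assoc_iso U V W))

theorem id_compHom [Finite G] (a : BurnsideGroup G H) :
    compHom (of (Biset.iso (MulEquiv.refl G))) a = a := by
  induction a using induction_on with
  | sub a a' h h' => simp only [map_sub, h, h']
  | of U =>
    rw [compHom_of]
    exact congrArg Algebra.GrothendieckAddGroup.of (Quotient.sound (Biset.id_comp_iso U))

theorem compHom_id [Finite H] (a : BurnsideGroup G H) :
    compHom a (of (Biset.iso (MulEquiv.refl H))) = a := by
  induction a using induction_on with
  | sub a a' h h' => simp only [map_sub, AddMonoidHom.sub_apply, h, h']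
  | of U =>
    rw [compHom_of]
    exact congrArg Algebra.GrothendieckAddGroup.of (Quotient.sound (Biset.comp_id_iso U))

/-- The composition of the Burnside groups as a `ℤ`-bilinear map. -/
def compLin : BurnsideGroup G H →ₗ[ℤ] BurnsideGroup H K →ₗ[ℤ] BurnsideGroup G K :=
  LinearMap.mk₂ ℤ (fun a b => compHom a b) (fun _ _ _ => by simp) (fun _ _ _ => by simp)
    (fun _ _ _ => by simp) (fun _ _ _ => by simp)

end BurnsideGroup

/-- `kB(G, H) = k ⊗_ℤ B(G, H)`. -/
abbrev LinBurnside (k : Type v) [Field k] (G H : Type u) [Group G] [Group H] :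
    Type (max (u + 1) v) :=
  k ⊗[ℤ] BurnsideGroup G H

namespace LinBurnside

variable {k : Type v} [Field k]
variable {G H K L : Type u} [Group G] [Group H] [Group K] [Group L]

/-- The element of `kB(G, H)` given by a biset. -/
def of (k : Type v) [Field k] (U : Biset G H) : LinBurnside k G H :=
  (1 : k) ⊗ₜ[ℤ] BurnsideGroup.of U

/-- The `k`-bilinear extension `kB(G, H) × kB(H, K) → kB(G, K)` of the product of bisets. -/
def comp : LinBurnside k G H →ₗ[k] LinBurnside k H K →ₗ[k] LinBurnside k G K :=
  LinearMap.liftBaseChange k ((LinearMap.baseChangeHom ℤ k _ _).comp BurnsideGroup.compLin)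

theorem comp_tmul (c d : k) (a : BurnsideGroup G H) (b : BurnsideGroup H K) :
    comp (c ⊗ₜ[ℤ] a) (d ⊗ₜ[ℤ] b) = (c * d) ⊗ₜ[ℤ] BurnsideGroup.compHom a b := rfl

theorem comp_of (U : Biset G H) (V : Biset H K) :
    comp (of k U) (of k V) = of k (U.comp V) := by
  rw [of, of, comp_tmul, one_mul, BurnsideGroup.compHom_of, of]

theorem comp_assoc (a : LinBurnside k G H) (b : LinBurnside k H K) (c : LinBurnside k K L) :
    comp (comp a b) c = comp a (comp b c) := by
  induction a using TensorProduct.induction_on with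
  | zero => simp
  | add a a' h h' => simp only [map_add, LinearMap.add_apply, h, h']
  | tmul r a =>
    induction b using TensorProduct.induction_on with
    | zero => simp
    | add b b' h h' => simp only [map_add, LinearMap.add_apply, h, h']
    | tmul s b =>
      induction c using TensorProduct.induction_on with
      | zero => simp
      | add c c' h h' => simp only [map_add, h, h']
      | tmul t c => simp only [comp_tmul, BurnsideGroup.compHom_assoc, mul_assoc]

theorem id_comp [Finite G] (a : LinBurnside k G H) :
    comp (of k (Biset.iso (MulEquiv.refl G))) a = a := by
  induction a using TensorProduct.induction_on with
  | zero => simp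
  | add a a' h h' => simp only [map_add, h, h']
  | tmul r a => rw [of, comp_tmul, BurnsideGroup.id_compHom, one_mul]

theorem comp_id [Finite H] (a : LinBurnside k G H) :
    comp a (of k (Biset.iso (MulEquiv.refl H))) = a := by
  induction a using TensorProduct.induction_on with
  | zero => simp
  | add a a' h h' => simp only [map_add, LinearMap.add_apply, h, h']
  | tmul r a => rw [of, comp_tmul, BurnsideGroup.compHom_id, mul_one]

end LinBurnside

/-- The biset category `k𝒞`: its objects are the finite groups. -/
structure BisetCat (k : Type v) : Type (u + 1) where
  carrier : Type u
  [group : Group carrier]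
  [finite : Finite carrier]

attribute [instance] BisetCat.group BisetCat.finite

namespace BisetCat

variable (k : Type v) [Field k]

/-- A finite group, as an object of the biset category. -/
abbrev of (G : Type u) [Group G] [Finite G] : BisetCat.{u} k := ⟨G⟩

/-- Morphisms `G ⟶ H` are the elements of `kB(H, G)`; the composition is the `k`-bilinear
extension of the product of bisets and the identity is the class of the biset `G`. -/
instance : Category.{max (u + 1) v} (BisetCat.{u} k) where
  Hom G H := LinBurnside k H.carrier G.carrier
  id G := LinBurnside.of k (Biset.iso (MulEquiv.refl G.carrier))
  comp f g := LinBurnside.comp g f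
  id_comp f := LinBurnside.comp_id f
  comp_id f := LinBurnside.id_comp f
  assoc f g h := (LinBurnside.comp_assoc h g f).symm

instance : Preadditive (BisetCat.{u} k) where
  homGroup G H := inferInstanceAs (AddCommGroup (LinBurnside k H.carrier G.carrier))
  add_comp _ Q R f f' g :=
    (LinBurnside.comp (show LinBurnside k R.carrier Q.carrier from g)).map_add f f'
  comp_add _ _ _ f g g' := LinearMap.map_add₂ LinBurnside.comp g g' f

instance : CategoryTheory.Linear k (BisetCat.{u} k) where
  homModule G H := inferInstanceAs (Module k (LinBurnside k H.carrier G.carrier))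
  smul_comp _ Q R r f g :=
    (LinBurnside.comp (show LinBurnside k R.carrier Q.carrier from g)).map_smul r f
  comp_smul _ _ _ f r g := LinearMap.map_smul₂ LinBurnside.comp r g f

variable {G H : Type u} [Group G] [Finite G] [Group H] [Finite H]

/-- The morphism `G ⟶ H` of the biset category given by an `(H, G)`-biset. -/
def ofBiset (U : Biset H G) : of k G ⟶ of k H := LinBurnside.of k U

/-- The morphism `Iso_σ : G ⟶ H` of the biset category given by a group isomorphism. -/
def isoHom (σ : G ≃* H) : of k G ⟶ of k H := ofBiset k (Biset.iso σ)

end BisetCat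

/-- A biset functor is a `k`-linear functor from the biset category to `k`-vector spaces. -/
structure BisetFunctor (k : Type v) [Field k] where
  toFunctor : BisetCat.{u} k ⥤ ModuleCat.{w} k
  [additive : toFunctor.Additive]
  [linear : toFunctor.Linear k]

namespace BisetFunctor

variable {k : Type v} [Field k]

/-- The evaluation `F(G)` of a biset functor at a finite group `G`. -/
abbrev eval (F : BisetFunctor.{u, v, w} k) (G : Type u) [Group G] [Finite G] : Type w :=
  F.toFunctor.obj (BisetCat.of k G)

/-- The `k`-linear map `F(φ) : F(G) → F(H)` attached to a morphism `φ ∈ kB(H, G)`. -/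
abbrev map (F : BisetFunctor.{u, v, w} k) {G H : Type u} [Group G] [Finite G] [Group H]
    [Finite H] (φ : BisetCat.of k G ⟶ BisetCat.of k H) : F.eval G →ₗ[k] F.eval H :=
  (F.toFunctor.map φ).hom

/-- A subfunctor of a biset functor: subspaces of all evaluations, preserved by all morphisms. -/
structure Subfunctor (F : BisetFunctor.{u, v, w} k) where
  space : ∀ (G : Type u) [Group G] [Finite G], Submodule k (F.eval G)
  map_mem : ∀ (G H : Type u) [Group G] [Finite G] [Group H] [Finite H]
    (φ : BisetCat.of k G ⟶ BisetCat.of k H) (a : F.eval G),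
    a ∈ space G → F.map φ a ∈ space H

/-- A biset functor is simple if it is non-zero and has no proper non-zero subfunctor. -/
def IsSimple (F : BisetFunctor.{u, v, w} k) : Prop :=
  (∃ (G : Type u) (_ : Group G) (_ : Finite G), Nontrivial (F.eval G)) ∧
  ∀ P : F.Subfunctor,
    (∀ (G : Type u) [Group G] [Finite G], P.space G = ⊥) ∨
    (∀ (G : Type u) [Group G] [Finite G], P.space G = ⊤)

end BisetFunctor

/-- The subgroup `Inn(H)` of inner automorphisms of `H`. -/
abbrev Inn (H : Type u) [Group H] : Subgroup (MulAut H) := (MulAut.conj : H →* MulAut H).range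

instance (H : Type u) [Group H] : (Inn H).Normal where
  conj_mem := by
    rintro _ ⟨h, rfl⟩ σ
    refine ⟨σ h, ?_⟩
    ext a
    simp [MulAut.conj_apply]

/-- The group `Out(H) = Aut(H) / Inn(H)` of outer automorphisms of `H`. -/
abbrev Out (H : Type u) [Group H] : Type u := MulAut H ⧸ Inn H

/-- `S` is the simple biset functor `S_{H,V}` (which is determined up to isomorphism), where `V`
is a `k`-space endowed with a representation `ρ` of `Out(H)`: the functor `S` is simple, `H` is a
group of minimal order such that `S(H) ≠ 0`, and `S(H)` is isomorphic to `V` as a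
`k Out(H)`-module, the class of an automorphism `σ` of `H` acting on `S(H)` by `S(Iso_σ)`. -/
structure BisetFunctor.IsSimpleAt {k : Type v} [Field k] (S : BisetFunctor.{u, v, w} k)
    (H : Type u) [Group H] [Finite H] {V : Type x} [AddCommGroup V] [Module k V]
    (ρ : Representation k (Out H) V) : Prop where
  isSimple : S.IsSimple
  nontrivial : Nontrivial (S.eval H)
  minimal : ∀ (K : Type u) [Group K] [Finite K], Nontrivial (S.eval K) → Nat.card H ≤ Nat.card K
  module_iso : ∃ e : S.eval H ≃ₗ[k] V, ∀ (σ : MulAut H) (a : S.eval H),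
    e (S.map (BisetCat.isoHom k σ) a) = ρ (QuotientGroup.mk σ) (e a)

end

/-- `H ⊑ G`: the group `H` is isomorphic to a subquotient `T / S` of `G`, where `(T, S)` is a
section of `G`, i.e. `T` is a subgroup of `G` and `S` is a normal subgroup of `T`. -/
def IsSubquotient (H G : Type u) [Group H] [Group G] : Prop :=
  ∃ (T : Subgroup G) (S : Subgroup T) (_ : S.Normal), Nonempty (H ≃* T ⧸ S)

/-! Non-vanishing of a biset functor passes from a quotient up to the group. For a surjection `f : G
→* H`, inflating along `f` and then deflating is the identity of `H` in the biset category
(`BisetCat.inf_comp_defl`), so by functoriality `S(H)` is a direct summand of `S(G)`. Since `S(H) ≠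
0` for `S = S_{H,V}`, it is enough to find a surjection from `G` onto `H`.

When `H` is a subquotient of a finite abelian group `A`, such a surjection from `A` exists by
character duality. Restriction of characters from `A` to a subgroup `T` is onto, and a finite
abelian group is isomorphic to its dual, so `T` is a quotient of `A`; hence so is every `T / N`.
With `A = G/[G,G]`, precomposing with `G → G/[G,G]` gives the result. -/

section

open CategoryTheory

variable {G H : Type u} [Group G] [Group H]

/-! ### Inflation and deflation bisets along a homomorphism -/

/-- The left action of `G` on `H` through a group homomorphism `f : G →* H`. -/
abbrev Biset.homLeft (f : G →* H) : MulAction G H where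
  smul g a := f g * a
  one_smul a := by
    change f 1 * a = a
    simp
  mul_smul g g' a := by
    change f (g * g') * a = f g * (f g' * a)
    simp [mul_assoc]

/-- The right action of `G` on `H` through a group homomorphism `f : G →* H`. -/
abbrev Biset.homRight (f : G →* H) : MulAction Gᵐᵒᵖ H where
  smul g a := a * f g.unop
  one_smul a := by
    change a * f 1 = a
    simp
  mul_smul g g' a := by
    change a * f (g'.unop * g.unop) = a * f g'.unop * f g.unop
    simp [mul_assoc]

/-- The `(G, H)`-biset `H` with `G` acting through `f : G →* H`; this is inflation when `f` is
surjective. -/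
def Biset.inf [Finite H] (f : G →* H) : Biset G H :=
  letI := Biset.homLeft f
  { carrier := H
    comm := ⟨fun g h a => (mul_assoc (f g) a h.unop).symm⟩ }

/-- The `(H, G)`-biset `H` with `G` acting through `f : G →* H`; this is deflation when `f` is
surjective. -/
def Biset.defl [Finite H] (f : G →* H) : Biset H G :=
  letI := Biset.homRight f
  { carrier := H
    comm := ⟨fun h g a => (mul_assoc h a (f g.unop)).symm⟩ }

/-- The product `H ×_G H` identifies `(a f(g), b)` with `(a, f(g) b)`. As `f` is onto, every class
has exactly one representative `(1, b)`, and multiplication `(a, b) ↦ a b` finds it. -/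
theorem Biset.defl_comp_inf_iso [Finite H] (f : G →* H) (hf : Function.Surjective f) :
    ((Biset.defl f).comp (Biset.inf f)).IsIso (Biset.iso (MulEquiv.refl H)) := by
  refine ⟨⟨?_, ?_, ?_, ?_⟩, ?_, ?_⟩
  · refine Quotient.lift (fun p : H × H => p.1 * p.2) ?_
    rintro ⟨a, b⟩ ⟨a', b'⟩ ⟨g, r1, r2⟩
    have r1' : a' = (show H from a) * f g := r1
    have r2' : b = f g * (show H from b') := r2
    change (show H from a) * (show H from b) = (show H from a') * (show H from b')
    rw [r1', r2', mul_assoc]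
  · exact fun b => comp.mk (U := Biset.defl f) (V := Biset.inf f) (1 : H) b
  · rintro ⟨(a : H), (b : H)⟩
    -- The only use of surjectivity: writing `a = f(g)` moves `a` across the product, from `(f(g),
    -- b)` to `(1, f(g) b)`.
    obtain ⟨g, rfl⟩ := hf a
    refine (comp.mk_smul (U := Biset.defl f) (V := Biset.inf f) g (1 : H) b).symm.trans ?_
    exact congrArg (fun t => comp.mk (U := Biset.defl f) (V := Biset.inf f) t b) (one_mul (f g))
  · exact fun b => one_mul (show H from b)
  · rintro h ⟨(a : H), (b : H)⟩
    exact mul_assoc h a b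
  · rintro h ⟨(a : H), (b : H)⟩
    exact (mul_assoc a b h).symm

/-! ### Splitting of inflation by deflation for biset functors -/

variable [Finite G] [Finite H]

/-- Composition in the category reverses the order of the biset product, so inflation followed by
deflation is the class of `defl ×_G inf`; the identity is the class of the biset `H`, and isomorphic
bisets have equal classes. -/
theorem BisetCat.inf_comp_defl (k : Type v) [Field k] (f : G →* H)
    (hf : Function.Surjective f) :
    BisetCat.ofBiset k (Biset.inf f) ≫ BisetCat.ofBiset k (Biset.defl f) =
      𝟙 (BisetCat.of k H) := by
  refine (LinBurnside.comp_of (k := k) (Biset.defl f) (Biset.inf f)).trans ?_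
  exact congrArg (fun a => (1 : k) ⊗ₜ[ℤ] Algebra.GrothendieckAddGroup.of a)
    (Quotient.sound (Biset.defl_comp_inf_iso f hf))

/-- The evaluation of a biset functor at a group embeds, by inflation, into its evaluation at
any group of which it is a quotient. -/
theorem BisetFunctor.nontrivial_eval_of_surjective {k : Type v} [Field k]
    (S : BisetFunctor.{u, v, w} k) (f : G →* H) (hf : Function.Surjective f)
    [Nontrivial (S.eval H)] : Nontrivial (S.eval G) := by
  -- `S(Def)` is a retraction of `S(Inf)`, which is therefore injective.
  have key : Function.LeftInverse (S.map (BisetCat.ofBiset k (Biset.defl f)))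
      (S.map (BisetCat.ofBiset k (Biset.inf f))) := by
    intro a
    have h := S.toFunctor.map_comp (BisetCat.ofBiset k (Biset.inf f))
      (BisetCat.ofBiset k (Biset.defl f))
    rw [BisetCat.inf_comp_defl k f hf, S.toFunctor.map_id] at h
    exact (LinearMap.congr_fun (congrArg ModuleCat.Hom.hom h) a).symm
  exact key.injective.nontrivial

end

/-! ### Subquotients of finite abelian groups are quotients -/

/-- A subgroup of a finite commutative group is isomorphic to a quotient of that group. -/
theorem Subgroup.exists_surjective_of_commGroup {A : Type*} [CommGroup A] [Finite A]
    (T : Subgroup A) : ∃ f : A →* T, Function.Surjective f := by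
  -- Non-zero exponents ensure that `ℂ` has enough roots of unity for both dual groups. The field
  -- `ℂ` is auxiliary here, unrelated to the coefficient field `k`.
  have : NeZero (Monoid.exponent A) := ⟨Monoid.exponent_ne_zero_of_finite⟩
  have : NeZero (Monoid.exponent T) := ⟨Monoid.exponent_ne_zero_of_finite⟩
  obtain ⟨e⟩ := CommGroup.monoidHom_mulEquiv_of_hasEnoughRootsOfUnity A ℂ
  obtain ⟨e'⟩ := CommGroup.monoidHom_mulEquiv_of_hasEnoughRootsOfUnity T ℂ
  -- The composite `A ≅ Hom(A, ℂˣ) → Hom(T, ℂˣ) ≅ T`, with non-canonical outer isomorphisms. The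
  -- middle map is onto because characters of `T` extend to `A`.
  refine ⟨e'.toMonoidHom.comp ((MonoidHom.domRestrictHom T ℂˣ).comp e.symm.toMonoidHom), ?_⟩
  exact e'.surjective.comp
    ((MonoidHom.domRestrict_surjective ℂ T).comp e.symm.surjective)

/-- A subquotient of a finite commutative group is a quotient of that group. -/
theorem IsSubquotient.exists_surjective {H A : Type u} [Group H] [CommGroup A] [Finite A]
    (h : IsSubquotient H A) : ∃ f : A →* H, Function.Surjective f := by
  obtain ⟨T, N, _, ⟨e⟩⟩ := h
  obtain ⟨f, hf⟩ := T.exists_surjective_of_commGroup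
  -- The composite `A → T → T / N ≅ H`.
  exact ⟨e.symm.toMonoidHom.comp ((QuotientGroup.mk' N).comp f),
    e.symm.surjective.comp ((QuotientGroup.mk'_surjective N).comp hf)⟩

theorem proposition3p2 {k : Type v} [Field k]
    (H : Type u) [Group H] [Finite H]
    (V : Type x) [AddCommGroup V] [Module k V]
    (ρ : Representation k (Out H) V) (hρ : ρ.IsIrreducible)
    (S : BisetFunctor.{u, v, w} k) (hS : S.IsSimpleAt H ρ)
    (G : Type u) [Group G] [Finite G] :
    (IsSubquotient H (G ⧸ commutator G) → Nontrivial (S.eval G)) ∧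
    ((∀ a b : G, a * b = b * a) → IsSubquotient H G →
      (∀ a b : H, a * b = b * a) ∧ Nontrivial (S.eval G)) := by
  have := hS.nontrivial
  refine ⟨fun h => ?_, fun hG h => ?_⟩
  · obtain ⟨f, hf⟩ :=
      -- `Abelianization G` is `G ⧸ commutator G` by definition; naming it this way supplies the
      -- commutative group structure.
      IsSubquotient.exists_surjective (A := Abelianization G) h
    exact S.nontrivial_eval_of_surjective (f.comp Abelianization.of)
      (hf.comp (QuotientGroup.mk'_surjective (commutator G)))
  -- Built on the given group structure, so `S.eval G` keeps its meaning.
  · let : CommGroup G := { ‹Group G› with mul_comm := hG }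
    obtain ⟨f, hf⟩ := IsSubquotient.exists_surjective (A := G) h
    refine ⟨fun a b => ?_, S.nontrivial_eval_of_surjective f hf⟩
    -- `H` is commutative as a homomorphic image of `G`.
    obtain ⟨a, rfl⟩ := hf a
    obtain ⟨b, rfl⟩ := hf b
    rw [← map_mul, hG, map_mul]
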